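/- Represent a partition $\pi$ by its Ferrers diagram. Fill the boxes of the odd-indexed rows (first, third, …) alternately with $a,b,a,b,\dots$ starting from $a$, and those of the even-indexed rows alternately with $c,d,c,d,\dots$ starting from $c$, and let $\omega_\pi(a,b,c,d)=a^{\#a}b^{\#b}c^{\#c}d^{\#d}$, where $\#a,\#b,\#c,\#d$ are the numbers of boxes containing each letter. For $M\ge 0$ let $U_M$ be the set of partitions with all parts $\le M$, let $D_M\subseteq U_M$ be the set of those with distinct parts (the empty partition belongs to both), and put $$\Phi_M(a,b,c,d)=\sum_{\pi\in U_M}\omega_\pi(a,b,c,d),\qquad \Psi_M(a,b,c,d)=\sum_{\pi\in D_M}\omega_\pi(a,b,c,d).$$ Write $(x;q)_L=\prod_{n=0}^{L-1}(1-xq^n)$ and $\left[{k\atop n}\right]_q=\frac{(q;q)_k}{(q;q)_n(q;q)_{k-n}}$ for $0\le n\le k$ (and $0$ otherwise). Theorem. Let $N\ge 0$ be an integer, $\nu\in\{0,1\}$, and $Q=abcd$. Then $$\Phi_{2N+\nu}(a,b,c,d)=\frac{1}{(Q;Q)_N}\sum_{i=0}^N\left[{N\atop i}\right]_Q\frac{(-a;Q)_{i+\nu}\,(-abc;Q)_i}{(ac;Q)_{i+\nu}}\,(ab)^{N-i},$$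 $$\Psi_{2N+\nu}(a,b,c,d)=\sum_{i=0}^N\left[{N\atop i}\right]_Q(-a;Q)_{i+\nu}\,(-abc;Q)_i\,\frac{(ac;Q)_{N+\nu}}{(ac;Q)_{i+\nu}}\,(ab)^{N-i}.$$ Both identities hold as identities of formal power series in the variables $a,b,c,d$ over any field. Moreover, for complex numbers $a,b,c,d$, the series $\Phi_{2N+\nu}$ converges unconditionally and the first identity holds whenever $|Q|<1$ and $|ac|<1$; the second holds whenever $(Q;Q)_N\ne 0$ and $(ac;Q)_{N+\nu}\ne 0$. -/

import Mathlib

open scoped MvPowerSeries.WithPiTopology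

/-- The `q`-shifted factorial `(a; q)_L = ∏_{n=0}^{L-1} (1 - a q^n)`. -/
def qPoch {R : Type*} [CommRing R] (a q : R) (L : ℕ) : R :=
  ∏ n ∈ Finset.range L, (1 - a * q ^ n)

/-- The Gaussian binomial coefficient `(q;q)_k / ((q;q)_n (q;q)_{k-n})` for `n ≤ k`, zero otherwise.
It is used in fields and in rings of formal power series over a field, with their usual inverse. -/
def qBinom {R : Type*} [CommRing R] [Inv R] (q : R) (k n : ℕ) : R :=
  if n ≤ k then qPoch q q k * (qPoch q q n * qPoch q q (k - n))⁻¹ else 0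

/-- The letter in the box `(i, j)` (row `i`, column `j`, both counted from `0`): rows alternate
`a b a b …` and `c d c d …`, starting with `a b a b …` in the first row. -/
def boxLetter {R : Type*} (a b c d : R) (x : ℕ × ℕ) : R :=
  if Even x.1 then (if Even x.2 then a else b) else (if Even x.2 then c else d)

/-- The weight `a^{#a} b^{#b} c^{#c} d^{#d}` of the four-variable decorated Ferrers diagram of a
partition. Partitions are represented by their Ferrers (Young) diagrams. -/
def diagramWeight {R : Type*} [CommRing R] (a b c d : R) (μ : YoungDiagram) : R :=
  ∏ x ∈ μ.cells, boxLetter a b c d x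

/-- The set `U_M` of partitions with all parts at most `M`;
`μ.rowLens` is the list of the (positive) parts. -/
def boundedPartitions (M : ℕ) : Set YoungDiagram :=
  {μ | ∀ p ∈ μ.rowLens, p ≤ M}

/-- The set `D_M` of partitions into distinct parts with all parts at most `M`. -/
def distinctPartitions (M : ℕ) : Set YoungDiagram :=
  {μ | (∀ p ∈ μ.rowLens, p ≤ M) ∧ μ.rowLens.Nodup}

theorem distinctPartitions_finite (M : ℕ) : (distinctPartitions M).Finite := by
  have hinj : Function.Injective YoungDiagram.cells := fun μ ν h => YoungDiagram.ext h
  refine Set.Finite.of_finite_image (f := YoungDiagram.cells) ?_ hinj.injOn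
  refine (Finset.finite_toSet
    (Finset.powerset (Finset.range (M + 1) ×ˢ Finset.range (M + 1)))).subset ?_
  rintro _ ⟨μ, ⟨hle, hnd⟩, rfl⟩
  have hlen : μ.rowLens.length ≤ M + 1 := by
    have h1 : μ.rowLens.toFinset ⊆ Finset.range (M + 1) := by
      intro p hp
      have := hle p (List.mem_toFinset.1 hp)
      exact Finset.mem_range.2 (by omega)
    have h2 := Finset.card_le_card h1
    rwa [List.toFinset_card_of_nodup hnd, Finset.card_range] at h2
  simp only [Finset.coe_powerset, Set.mem_preimage, Set.mem_powerset_iff]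
  intro x hx
  have hx' : (x.1, x.2) ∈ μ := hx
  have hrow : x.2 < μ.rowLen x.1 := YoungDiagram.mem_iff_lt_rowLen.1 hx'
  have hcol : x.1 < μ.colLen 0 :=
    YoungDiagram.mem_iff_lt_colLen.1 (μ.up_left_mem le_rfl (Nat.zero_le _) hx')
  have hmem : μ.rowLen x.1 ∈ μ.rowLens :=
    List.mem_map.2 ⟨x.1, List.mem_range.2 hcol, rfl⟩
  have h3 := hle _ hmem
  rw [YoungDiagram.length_rowLens] at hlen
  simp only [Finset.coe_product, Set.mem_prod, Finset.mem_coe, Finset.mem_range]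
  omega

/-- The generating function `Ψ_M(a,b,c,d) = ∑_{π ∈ D_M} ω_π(a,b,c,d)`, a finite sum. -/
noncomputable def distinctGenFun {R : Type*} [CommRing R] (M : ℕ) (a b c d : R) : R :=
  ∑ μ ∈ (distinctPartitions_finite M).toFinset, diagramWeight a b c d μ

/-!
Let `Φ'` and `Ψ'` be the generating functions with the pairs `(a, b)` and `(c, d)` interchanged, and
let `r_M`, `r'_M` be the weights of a first row of length `M` before and after this interchange.
Deleting the first row of a Ferrers diagram interchanges the two pairs of letters. Splitting off a
first row of the maximal length thus gives
`Ψ_{M+1} = Ψ_M + r_{M+1} Ψ'_M` and `Φ_{M+1} = Φ_M + r_{M+1} Φ'_{M+1}`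
(`distinctGenFun_succ`, `tsum_boundedPartitions_succ`).

Eliminating `Ψ'` leaves the three-term recurrences
`Ψ_{2m+1} = (1 + a) Ψ_{2m} - a (1 - Q^m) Ψ_{2m-1}` and
`Ψ_{2m+2} = (1 + b) Ψ_{2m+1} - b (1 - a c Q^m) Ψ_{2m}`.
The closed form, written without division, is a polynomial in `a`, `b`, `z = a c` and `q = Q`, and
satisfies the same recurrences even when `z` and `q` are independent of `a` and `b`: the first one
telescopes (`closedForm_one_succ`), the second one follows from the `q`-Pascal rule
(`closedForm_zero_succ`). Hence the identity for `Ψ` holds in every commutative ring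
(`distinctGenFun_eq_closedForm`), and quotients enter only where the `q`-factorials are units.

Eliminating `Φ'` in the same way gives `Φ_M ∏_{k ≤ M} (1 - r_k r'_k) = Ψ_M`
(`tsum_boundedPartitions_mul_pairProduct`), where the product is `(Q; Q)_N (a c; Q)_{N+ν}` for
`M = 2 N + ν`. This elimination presupposes that the series converge. Over `ℂ` they are dominated by
products of geometric series in `r_k r'_k` (`summable_norm_diagramWeight`); for formal power series
only finitely many diagrams have a given number of cells (`summable_diagramWeight_X`).
-/

/-! ### `q`-shifted factorials and Gaussian binomials -/

section QSeries

variable {R : Type*} [CommRing R]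

theorem qPoch_zero (x q : R) : qPoch x q 0 = 1 := by simp [qPoch]

theorem qPoch_succ (x q : R) (n : ℕ) : qPoch x q (n + 1) = qPoch x q n * (1 - x * q ^ n) := by
  simp [qPoch, Finset.prod_range_succ]

theorem qPoch_add (x q : R) (m n : ℕ) :
    qPoch x q (m + n) = qPoch x q m * qPoch (x * q ^ m) q n := by
  simp only [qPoch, Finset.prod_range_add]
  congr 1
  refine Finset.prod_congr rfl fun i _ => ?_
  rw [pow_add, mul_assoc]

theorem qPoch_succ' (x q : R) (i n : ℕ) :
    qPoch (x * q ^ i) q (n + 1) = (1 - x * q ^ i) * qPoch (x * q ^ (i + 1)) q n := by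
  rw [add_comm n 1, qPoch_add]
  simp [qPoch, pow_succ, mul_assoc]

/-- The Gaussian binomial coefficient as a polynomial in `q`, defined by the `q`-Pascal rule, so
that it makes sense in every commutative ring. -/
def gaussBinom (q : R) : ℕ → ℕ → R
  | _, 0 => 1
  | 0, _ + 1 => 0
  | n + 1, k + 1 => q ^ (k + 1) * gaussBinom q n (k + 1) + gaussBinom q n k

theorem gaussBinom_zero_right (q : R) (n : ℕ) : gaussBinom q n 0 = 1 := by
  cases n <;> rfl

theorem gaussBinom_succ_succ (q : R) (n k : ℕ) :
    gaussBinom q (n + 1) (k + 1) = q ^ (k + 1) * gaussBinom q n (k + 1) + gaussBinom q n k := rfl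

theorem gaussBinom_eq_zero_of_lt (q : R) {n k : ℕ} (h : n < k) : gaussBinom q n k = 0 := by
  induction n generalizing k with
  | zero => obtain ⟨k, rfl⟩ := Nat.exists_eq_succ_of_ne_zero h.ne'; rfl
  | succ n ih =>
    obtain ⟨k, rfl⟩ := Nat.exists_eq_succ_of_ne_zero (Nat.ne_zero_of_lt h)
    rw [Nat.succ_eq_add_one, gaussBinom_succ_succ, ih (by omega), ih (by omega)]
    ring

theorem gaussBinom_self (q : R) (n : ℕ) : gaussBinom q n n = 1 := by
  induction n with
  | zero => rfl
  | succ n ih =>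
    rw [gaussBinom_succ_succ, ih, gaussBinom_eq_zero_of_lt q (Nat.lt_succ_self n)]
    ring

/-- The relation between `(n + 1, k)` and `(n, k)` follows from the one between `(n, k + 1)` and
`(n, k)`. It serves in the inductive proof of the latter, `gaussBinom_succ_right_mul`, and then holds
unconditionally, `gaussBinom_succ_left_mul`. -/
theorem gaussBinom_succ_left_of_succ_right {q : R} {n : ℕ}
    (h : ∀ k, gaussBinom q n (k + 1) * (1 - q ^ (k + 1)) = gaussBinom q n k * (1 - q ^ (n - k)))
    {k : ℕ} (hk : k ≤ n) :
    gaussBinom q (n + 1) k * (1 - q ^ (n + 1 - k)) = gaussBinom q n k * (1 - q ^ (n + 1)) := by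
  cases k with
  | zero => simp [gaussBinom_zero_right]
  | succ j =>
    obtain ⟨l, rfl⟩ := Nat.exists_eq_add_of_le hk
    have h1 := h j
    rw [gaussBinom_succ_succ]
    rw [show j + 1 + l - j = l + 1 by omega] at h1
    rw [show j + 1 + l + 1 - (j + 1) = l + 1 by omega]
    linear_combination -h1

theorem gaussBinom_succ_right_mul (q : R) (n k : ℕ) :
    gaussBinom q n (k + 1) * (1 - q ^ (k + 1)) = gaussBinom q n k * (1 - q ^ (n - k)) := by
  induction n generalizing k with
  | zero => simp [gaussBinom_eq_zero_of_lt]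
  | succ n ih =>
    rcases Nat.lt_or_ge n k with hk | hk
    · rw [gaussBinom_eq_zero_of_lt q (by omega : n + 1 < k + 1),
        show n + 1 - k = 0 by omega]
      simp
    · rw [gaussBinom_succ_left_of_succ_right ih hk, gaussBinom_succ_succ]
      obtain ⟨l, rfl⟩ := Nat.exists_eq_add_of_le hk
      have h1 := ih k
      rw [show k + l - k = l by omega] at h1
      linear_combination q ^ (k + 1) * h1

theorem gaussBinom_succ_left_mul (q : R) {n k : ℕ} (hk : k ≤ n) :
    gaussBinom q (n + 1) k * (1 - q ^ (n + 1 - k)) = gaussBinom q n k * (1 - q ^ (n + 1)) :=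
  gaussBinom_succ_left_of_succ_right (gaussBinom_succ_right_mul q n) hk

theorem gaussBinom_mul_qPoch (q : R) {n k : ℕ} (hk : k ≤ n) :
    gaussBinom q n k * (qPoch q q k * qPoch q q (n - k)) = qPoch q q n := by
  induction n with
  | zero => obtain rfl : k = 0 := by omega
            simp [qPoch_zero, gaussBinom_self]
  | succ n ih =>
    rcases Nat.lt_or_ge n k with h | h
    · obtain rfl : k = n + 1 := by omega
      simp [qPoch_zero, gaussBinom_self]
    · have h1 := gaussBinom_succ_left_mul q h
      have h2 := ih h
      obtain ⟨l, rfl⟩ := Nat.exists_eq_add_of_le h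
      rw [show k + l + 1 - k = l + 1 by omega] at h1 ⊢
      rw [show k + l - k = l by omega] at h2
      rw [qPoch_succ, qPoch_succ]
      linear_combination (qPoch q q k * qPoch q q l) * h1 + (1 - q ^ (k + l + 1)) * h2

/-! ### The closed form and its recurrences -/

/-- The `i`-th summand of the closed form for `Ψ_{2N+ν}`, with `z` in the role of `ac` and `q` in
that of `abcd`. The quotient of `q`-factorials is written as the product it stands for, and `z` and
`q` are independent of `a` and `b`. -/
def closedTerm (a b z q : R) (ν N i : ℕ) : R :=
  gaussBinom q N i * (qPoch (-a) q (i + ν) * qPoch (-(b * z)) q i) *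
    qPoch (z * q ^ (i + ν)) q (N - i) * (a * b) ^ (N - i)

/-- The closed form for `Ψ_{2N+ν}` as a polynomial in `a`, `b`, `z = ac` and `q = abcd`. -/
def closedForm (a b z q : R) (ν N : ℕ) : R :=
  ∑ i ∈ Finset.range (N + 1), closedTerm a b z q ν N i

theorem closedTerm_eq_zero_of_lt (a b z q : R) (ν : ℕ) {N i : ℕ} (h : N < i) :
    closedTerm a b z q ν N i = 0 := by
  simp [closedTerm, gaussBinom_eq_zero_of_lt q h]

theorem closedForm_zero_zero (a b z q : R) : closedForm a b z q 0 0 = 1 := by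
  simp [closedForm, closedTerm, qPoch_zero, gaussBinom_self]

theorem closedForm_one_zero (a b z q : R) : closedForm a b z q 1 0 = 1 + a := by
  simp [closedForm, closedTerm, qPoch, gaussBinom_self]

/-- The summands of the recurrence `closedForm_one_succ` telescope. -/
theorem closedTerm_telescope (a b z q : R) {m i : ℕ} (hi : i ≤ m + 1) :
    closedTerm a b z q 1 (m + 1) i - (1 + a) * closedTerm a b z q 0 (m + 1) i +
        a * (1 - q ^ (m + 1)) * closedTerm a b z q 1 m i =
      a * (1 - q ^ (i + 1)) * closedTerm a b z q 0 (m + 1) (i + 1) -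
        a * (1 - q ^ i) * closedTerm a b z q 0 (m + 1) i := by
  rcases Nat.lt_or_ge m i with h | h
  · obtain rfl : i = m + 1 := by omega
    rw [closedTerm_eq_zero_of_lt a b z q 1 h,
      closedTerm_eq_zero_of_lt a b z q 0 (Nat.lt_succ_self (m + 1))]
    simp only [closedTerm, Nat.sub_self, qPoch_zero, pow_zero, gaussBinom_self, add_zero,
      qPoch_succ (-a)]
    ring
  · obtain ⟨k, rfl⟩ := Nat.exists_eq_add_of_le h
    have h1 := gaussBinom_succ_right_mul q (i + k + 1) i
    have h2 := gaussBinom_succ_left_mul q h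
    simp only [closedTerm, add_zero]
    rw [show i + k + 1 - i = k + 1 by omega] at h1 h2 ⊢
    rw [show i + k + 1 - (i + 1) = k by omega, show i + k - i = k by omega,
      qPoch_succ' z q i k, qPoch_succ (z * q ^ (i + 1)), qPoch_succ (-a), qPoch_succ (-(b * z))]
    linear_combination
      (-a * (qPoch (-a) q i * (1 + a * q ^ i) * qPoch (-(b * z)) q i) *
        qPoch (z * q ^ (i + 1)) q k * (a * b) ^ k) * h2 -
      (a * (qPoch (-a) q i * (1 + a * q ^ i) * qPoch (-(b * z)) q i * (1 + b * z * q ^ i)) *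
        qPoch (z * q ^ (i + 1)) q k * (a * b) ^ k) * h1

theorem closedForm_one_succ (a b z q : R) (m : ℕ) :
    closedForm a b z q 1 (m + 1) =
      (1 + a) * closedForm a b z q 0 (m + 1) - a * (1 - q ^ (m + 1)) * closedForm a b z q 1 m := by
  have h0 : closedForm a b z q 1 m = ∑ i ∈ Finset.range (m + 1 + 1), closedTerm a b z q 1 m i := by
    rw [Finset.sum_range_succ, closedTerm_eq_zero_of_lt a b z q 1 (Nat.lt_succ_self m), add_zero]
    rfl
  have h1 := Finset.sum_congr (rfl : Finset.range (m + 1 + 1) = _) fun i hi =>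
    closedTerm_telescope a b z q (m := m) (i := i) (by simp at hi; omega)
  rw [Finset.sum_range_sub (fun i => a * (1 - q ^ i) * closedTerm a b z q 0 (m + 1) i),
    closedTerm_eq_zero_of_lt a b z q 0 (Nat.lt_succ_self (m + 1)), Finset.sum_add_distrib,
    Finset.sum_sub_distrib, ← Finset.mul_sum, ← Finset.mul_sum, ← h0] at h1
  change closedForm a b z q 1 (m + 1) - (1 + a) * closedForm a b z q 0 (m + 1) + _ = _ at h1
  linear_combination h1

theorem closedForm_zero_succ (a b z q : R) (m : ℕ) :
    closedForm a b z q 0 (m + 1) =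
      (1 + b) * closedForm a b z q 1 m - b * (1 - z * q ^ m) * closedForm a b z q 0 m := by
  -- The two parts into which the `q`-Pascal rule splits the summands on the left.
  let A : ℕ → R := fun i => q ^ i * gaussBinom q m i * (qPoch (-a) q i * qPoch (-(b * z)) q i) *
    qPoch (z * q ^ i) q (m + 1 - i) * (a * b) ^ (m + 1 - i)
  let B : ℕ → R := fun i => gaussBinom q m i * (qPoch (-a) q (i + 1) * qPoch (-(b * z)) q (i + 1)) *
    qPoch (z * q ^ (i + 1)) q (m - i) * (a * b) ^ (m - i)
  have hA : A (m + 1) = 0 := by simp [A, gaussBinom_eq_zero_of_lt]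
  have h0 : closedTerm a b z q 0 (m + 1) 0 = A 0 := by
    simp [A, closedTerm, gaussBinom_zero_right]
  have h1 (i : ℕ) : closedTerm a b z q 0 (m + 1) (i + 1) = A (i + 1) + B i := by
    simp only [A, B, closedTerm, gaussBinom_succ_succ, add_zero, Nat.add_sub_add_right]
    ring
  have h2 : ∀ i ∈ Finset.range (m + 1), A i + B i = (1 + b) * closedTerm a b z q 1 m i -
      b * (1 - z * q ^ m) * closedTerm a b z q 0 m i := by
    intro i hi
    obtain ⟨k, rfl⟩ := Nat.exists_eq_add_of_le (Nat.lt_succ_iff.1 (Finset.mem_range.1 hi))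
    have h3 := qPoch_succ' z q i k
    have h4 := qPoch_succ (z * q ^ i) q k
    simp only [A, B, closedTerm, add_zero]
    rw [show i + k + 1 - i = k + 1 by omega, show i + k - i = k by omega, qPoch_succ (-a),
      qPoch_succ (-(b * z)), h3]
    rw [h3] at h4
    linear_combination (-b * gaussBinom q (i + k) i * (qPoch (-a) q i * qPoch (-(b * z)) q i) *
      (a * b) ^ k) * h4
  calc closedForm a b z q 0 (m + 1)
      = ∑ i ∈ Finset.range (m + 1), (A (i + 1) + B i) + A 0 := by
        rw [closedForm, Finset.sum_range_succ', h0]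
        simp only [h1]
    _ = ∑ i ∈ Finset.range (m + 1), (A i + B i) := by
        have h5 : ∑ i ∈ Finset.range (m + 1), A (i + 1) + A 0 = ∑ i ∈ Finset.range (m + 1), A i := by
          rw [← Finset.sum_range_succ', Finset.sum_range_succ, hA, add_zero]
        rw [Finset.sum_add_distrib, Finset.sum_add_distrib, ← h5]
        ring
    _ = _ := by
        rw [Finset.sum_congr rfl h2, Finset.sum_sub_distrib, ← Finset.mul_sum, ← Finset.mul_sum]
        rfl

end QSeries

/-! ### Adding a first row to a Young diagram -/

section Diagrams

variable {R : Type*} [CommRing R]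

/-- The weight of a row of length `k` filled alternately with `a, b, a, b, …`. -/
def rowWeight (a b : R) (k : ℕ) : R :=
  ∏ j ∈ Finset.range k, if Even j then a else b

theorem rowWeight_two_mul (a b : R) (m : ℕ) : rowWeight a b (2 * m) = (a * b) ^ m := by
  induction m with
  | zero => simp [rowWeight]
  | succ m ih =>
    rw [rowWeight, show 2 * (m + 1) = 2 * m + 1 + 1 by ring, Finset.prod_range_succ,
      Finset.prod_range_succ, ← rowWeight, ih]
    simp [pow_succ, mul_assoc]

theorem rowWeight_two_mul_add_one (a b : R) (m : ℕ) :
    rowWeight a b (2 * m + 1) = a * (a * b) ^ m := by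
  rw [rowWeight, Finset.prod_range_succ, ← rowWeight, rowWeight_two_mul]
  simp [mul_comm]

/-- The weight of a diagram in terms of its list of row lengths: deleting the first row interchanges
the pairs of letters `a, b` and `c, d`. -/
theorem prod_cellsOfRowLens_cons (a b c d : R) (k : ℕ) (l : List ℕ) :
    ∏ x ∈ YoungDiagram.cellsOfRowLens (k :: l), boxLetter a b c d x =
      rowWeight a b k * ∏ x ∈ YoungDiagram.cellsOfRowLens l, boxLetter c d a b x := by
  rw [YoungDiagram.cellsOfRowLens, Finset.prod_union, Finset.prod_map, Finset.prod_product]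
  · congr 1
    · simp [boxLetter, rowWeight]
    · refine Finset.prod_congr rfl fun x _ => ?_
      by_cases h : Even x.1 <;> simp [boxLetter, Nat.even_add_one, h]
  · rw [Finset.disjoint_left]
    rintro ⟨i, j⟩ h1 h2
    simp only [Finset.mem_product, Finset.mem_singleton] at h1
    simp [h1.1] at h2

theorem cons_rowLens_sortedGE {M : ℕ} {μ : YoungDiagram} (h : μ ∈ boundedPartitions M) :
    (M :: μ.rowLens).SortedGE :=
  List.Pairwise.sortedGE (List.pairwise_cons.2 ⟨fun p hp => h p hp, μ.rowLens_sorted.pairwise⟩)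

theorem rowLens_ofRowLens_cons {M : ℕ} {μ : YoungDiagram} (h : μ ∈ boundedPartitions (M + 1)) :
    (YoungDiagram.ofRowLens _ (cons_rowLens_sortedGE h)).rowLens = (M + 1) :: μ.rowLens := by
  refine YoungDiagram.rowLens_ofRowLens_eq_self fun x hx => ?_
  rcases List.mem_cons.1 hx with rfl | hx
  · exact Nat.succ_pos M
  · exact μ.pos_of_mem_rowLens x hx

/-- The diagram obtained from a diagram with rows of length at most `M + 1` by adding a first row
of length `M + 1`. -/
def addRow (M : ℕ) (μ : boundedPartitions (M + 1)) : boundedPartitions (M + 1) :=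
  ⟨YoungDiagram.ofRowLens ((M + 1) :: μ.1.rowLens) (cons_rowLens_sortedGE μ.2), by
    intro p hp
    rw [rowLens_ofRowLens_cons μ.2] at hp
    rcases List.mem_cons.1 hp with rfl | hp
    · rfl
    · exact μ.2 p hp⟩

theorem rowLens_addRow (M : ℕ) (μ : boundedPartitions (M + 1)) :
    (addRow M μ).1.rowLens = (M + 1) :: μ.1.rowLens :=
  rowLens_ofRowLens_cons μ.2

theorem diagramWeight_eq_prod_rowLens (a b c d : R) (μ : YoungDiagram) :
    diagramWeight a b c d μ =
      ∏ x ∈ YoungDiagram.cellsOfRowLens μ.rowLens, boxLetter a b c d x := by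
  conv_lhs => rw [← YoungDiagram.ofRowLens_to_rowLens_eq_self (μ := μ)]
  rfl

theorem diagramWeight_addRow (a b c d : R) (M : ℕ) (μ : boundedPartitions (M + 1)) :
    diagramWeight a b c d (addRow M μ).1 =
      rowWeight a b (M + 1) * diagramWeight c d a b μ.1 := by
  rw [diagramWeight_eq_prod_rowLens, rowLens_addRow, prod_cellsOfRowLens_cons,
    ← diagramWeight_eq_prod_rowLens]

theorem rowLens_injective : Function.Injective YoungDiagram.rowLens := fun _ _ h =>
  YoungDiagram.equivListRowLens.injective (Subtype.ext h)

theorem addRow_injective (M : ℕ) : Function.Injective (addRow M) := by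
  intro μ ν h
  have h1 := congrArg (fun x => x.1.rowLens) h
  simp only [rowLens_addRow, List.cons.injEq, true_and] at h1
  exact Subtype.ext (rowLens_injective h1)

theorem boundedPartitions_mono {M N : ℕ} (h : M ≤ N) :
    boundedPartitions M ⊆ boundedPartitions N :=
  fun _ hμ p hp => (hμ p hp).trans h

theorem distinctPartitions_subset (M : ℕ) : distinctPartitions M ⊆ boundedPartitions M :=
  fun _ hμ => hμ.1

theorem addRow_notMem (M : ℕ) (μ : boundedPartitions (M + 1)) :
    (addRow M μ).1 ∉ boundedPartitions M := by
  intro h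
  have := h (M + 1) (by simp [rowLens_addRow])
  omega

/-- A diagram with a row of length `M + 1` and no longer ones has a first row of that length. -/
theorem exists_addRow_eq {M : ℕ} {μ : YoungDiagram} (h : μ ∈ boundedPartitions (M + 1))
    (h' : μ ∉ boundedPartitions M) : ∃ ν, (addRow M ν).1 = μ := by
  have hs := μ.rowLens_sorted.pairwise
  have hp := μ.pos_of_mem_rowLens
  rcases hl : μ.rowLens with _ | ⟨k, l⟩
  · exact absurd (fun p hp => by simp [hl] at hp) h'
  · rw [hl, List.pairwise_cons] at hs
    have hk : k = M + 1 := by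
      by_contra hne
      refine h' fun p hp => ?_
      have h1 := h k (by simp [hl])
      rw [hl] at hp
      rcases List.mem_cons.1 hp with rfl | hp
      · omega
      · have := hs.1 p hp
        omega
    have hν : (YoungDiagram.ofRowLens l hs.2.sortedGE).rowLens = l :=
      YoungDiagram.rowLens_ofRowLens_eq_self fun x hx => hp x (by simp [hl, hx])
    refine ⟨⟨YoungDiagram.ofRowLens l hs.2.sortedGE, fun p hp => h p ?_⟩, rowLens_injective ?_⟩
    · rw [hν] at hp
      simp [hl, hp]
    · rw [rowLens_addRow, hν, hl, hk]

theorem boundedPartitions_succ (M : ℕ) :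
    boundedPartitions (M + 1) =
      boundedPartitions M ∪ Set.range (fun μ => (addRow M μ).1) := by
  ext μ
  constructor
  · intro h
    by_cases h' : μ ∈ boundedPartitions M
    · exact Or.inl h'
    · exact Or.inr (exists_addRow_eq h h')
  · rintro (h | ⟨ν, rfl⟩)
    · exact boundedPartitions_mono M.le_succ h
    · exact (addRow M ν).2

theorem boundedPartitions_zero : boundedPartitions 0 = {⊥} := by
  have h0 : YoungDiagram.rowLens ⊥ = [] := by
    rw [← List.length_eq_zero_iff, YoungDiagram.length_rowLens]
    by_contra h
    exact YoungDiagram.notMem_bot _ (YoungDiagram.mem_iff_lt_colLen.2 (Nat.pos_of_ne_zero h))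
  ext μ
  constructor
  · intro h
    refine rowLens_injective (h0.symm ▸ List.eq_nil_iff_forall_not_mem.2 fun p hp => ?_)
    have h1 := h p hp
    have h2 := μ.pos_of_mem_rowLens p hp
    omega
  · rintro rfl p hp
    simp [h0] at hp

theorem distinctPartitions_zero : distinctPartitions 0 = {⊥} := by
  refine Set.Subset.antisymm
    (boundedPartitions_zero ▸ distinctPartitions_subset 0) (Set.singleton_subset_iff.2 ?_)
  have h : ⊥ ∈ boundedPartitions 0 := by simp [boundedPartitions_zero]
  refine ⟨h, ?_⟩
  have h0 : YoungDiagram.rowLens ⊥ = [] := by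
    refine List.eq_nil_iff_forall_not_mem.2 fun p hp => ?_
    have h1 := h p hp
    have h2 := YoungDiagram.pos_of_mem_rowLens ⊥ p hp
    omega
  exact h0 ▸ List.nodup_nil

theorem distinctPartitions_succ (M : ℕ) :
    distinctPartitions (M + 1) = distinctPartitions M ∪
      Set.range (fun μ : distinctPartitions M =>
        (addRow M ⟨μ.1, boundedPartitions_mono M.le_succ (distinctPartitions_subset M μ.2)⟩).1) := by
  ext μ
  constructor
  · intro h
    by_cases h' : μ ∈ boundedPartitions M
    · exact Or.inl ⟨h', h.2⟩
    · obtain ⟨ν, rfl⟩ := exists_addRow_eq h.1 h'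
      have hnd := h.2
      rw [rowLens_addRow, List.nodup_cons] at hnd
      refine Or.inr ⟨⟨ν.1, fun p hp => ?_, hnd.2⟩, rfl⟩
      have h1 := ν.2 p hp
      have h2 : p ≠ M + 1 := fun h => hnd.1 (h ▸ hp)
      omega
  · rintro (h | ⟨ν, rfl⟩)
    · exact ⟨boundedPartitions_mono M.le_succ h.1, h.2⟩
    · refine ⟨(addRow M _).2, ?_⟩
      rw [rowLens_addRow, List.nodup_cons]
      refine ⟨fun h => ?_, ν.2.2⟩
      have := ν.2.1 _ h
      omega

theorem diagramWeight_bot (a b c d : R) : diagramWeight a b c d ⊥ = 1 := by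
  simp [diagramWeight]

/-! ### Partitions into distinct parts -/

theorem distinctGenFun_eq_finsum (M : ℕ) (a b c d : R) :
    distinctGenFun M a b c d = ∑ᶠ μ ∈ distinctPartitions M, diagramWeight a b c d μ :=
  (finsum_mem_eq_finite_toFinset_sum _ (distinctPartitions_finite M)).symm

theorem distinctGenFun_zero (a b c d : R) : distinctGenFun 0 a b c d = 1 := by
  rw [distinctGenFun_eq_finsum, distinctPartitions_zero, finsum_mem_singleton, diagramWeight_bot]

/-- Splitting off a first row of the maximal length. -/
theorem distinctGenFun_succ (M : ℕ) (a b c d : R) :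
    distinctGenFun (M + 1) a b c d =
      distinctGenFun M a b c d + rowWeight a b (M + 1) * distinctGenFun M c d a b := by
  have hfin := distinctPartitions_finite (M + 1)
  have hinj : Function.Injective (fun μ : distinctPartitions M =>
      (addRow M ⟨μ.1, boundedPartitions_mono M.le_succ (distinctPartitions_subset M μ.2)⟩).1) := by
    intro μ ν h
    have h1 := congrArg Subtype.val (addRow_injective M (Subtype.ext h))
    exact Subtype.ext h1
  rw [distinctPartitions_succ] at hfin
  simp only [distinctGenFun_eq_finsum]
  rw [distinctPartitions_succ, finsum_mem_union _ (hfin.subset Set.subset_union_left)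
    (hfin.subset Set.subset_union_right), finsum_mem_range hinj]
  · simp only [diagramWeight_addRow]
    rw [mul_finsum_mem' _ _ (distinctPartitions_finite M),
      finsum_set_coe_eq_finsum_mem (distinctPartitions M)
        (f := fun μ => rowWeight a b (M + 1) * diagramWeight c d a b μ)]
  · rw [Set.disjoint_left]
    rintro _ h ⟨ν, rfl⟩
    exact addRow_notMem M _ (distinctPartitions_subset M h)

/-- The recurrences of `distinctGenFun_succ` for `(a, b, c, d)` and `(c, d, a, b)` combine to a
three-term recurrence once the second generating function is eliminated. -/
theorem distinctGenFun_succ_succ (M : ℕ) (a b c d ρ : R)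
    (hρ : rowWeight a b (M + 2) = ρ * rowWeight a b (M + 1)) :
    distinctGenFun (M + 2) a b c d =
      (1 + ρ) * distinctGenFun (M + 1) a b c d -
        (ρ - rowWeight a b (M + 2) * rowWeight c d (M + 1)) * distinctGenFun M a b c d := by
  have h1 := distinctGenFun_succ (M + 1) a b c d
  have h2 := distinctGenFun_succ M a b c d
  have h3 := distinctGenFun_succ M c d a b
  rw [h3] at h1
  linear_combination h1 - ρ * h2 + distinctGenFun M c d a b * hρ

theorem distinctGenFun_eq_closedForm_aux (N : ℕ) (a b c d : R) :
    distinctGenFun (2 * N) a b c d = closedForm a b (a * c) (a * b * c * d) 0 N ∧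
      distinctGenFun (2 * N + 1) a b c d = closedForm a b (a * c) (a * b * c * d) 1 N := by
  induction N with
  | zero =>
    simp [distinctGenFun_succ, distinctGenFun_zero, closedForm_zero_zero, closedForm_one_zero,
      rowWeight]
  | succ N ih =>
    have h0 := rowWeight_two_mul_add_one a b N
    have h1 : rowWeight a b (2 * N + 2) = (a * b) ^ (N + 1) := rowWeight_two_mul a b (N + 1)
    have h2 : rowWeight a b (2 * N + 3) = a * (a * b) ^ (N + 1) :=
      rowWeight_two_mul_add_one a b (N + 1)
    have h3 := rowWeight_two_mul_add_one c d N
    have h4 : rowWeight c d (2 * N + 2) = (c * d) ^ (N + 1) := rowWeight_two_mul c d (N + 1)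
    have e1 := distinctGenFun_succ_succ (2 * N) a b c d b (by rw [h0, h1]; ring)
    have e2 := distinctGenFun_succ_succ (2 * N + 1) a b c d a (by rw [h1, h2])
    rw [h1, h3, ih.1, ih.2] at e1
    have e3 : distinctGenFun (2 * (N + 1)) a b c d =
        closedForm a b (a * c) (a * b * c * d) 0 (N + 1) := by
      rw [closedForm_zero_succ]
      refine e1.trans ?_
      rw [show a * b * c * d = (a * b) * (c * d) by ring, mul_pow]
      ring
    refine ⟨e3, ?_⟩
    have e4 : distinctGenFun (2 * N + 1 + 1) a b c d = _ := e3
    rw [h2, h4, ih.2, e4] at e2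
    rw [closedForm_one_succ]
    refine e2.trans ?_
    rw [show a * b * c * d = (a * b) * (c * d) by ring, mul_pow]
    ring

theorem distinctGenFun_eq_closedForm {ν : ℕ} (hν : ν = 0 ∨ ν = 1) (N : ℕ) (a b c d : R) :
    distinctGenFun (2 * N + ν) a b c d = closedForm a b (a * c) (a * b * c * d) ν N := by
  rcases hν with rfl | rfl
  · exact (distinctGenFun_eq_closedForm_aux N a b c d).1
  · exact (distinctGenFun_eq_closedForm_aux N a b c d).2

end Diagrams

/-! ### Partitions with bounded parts -/

section Bounded

variable {R : Type*} [CommRing R]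

/-- The product of `1 - ω_k` over `1 ≤ k ≤ M`, where `ω_k` is the weight of two adjacent rows of
length `k`. -/
def pairProduct (M : ℕ) (a b c d : R) : R :=
  ∏ k ∈ Finset.range M, (1 - rowWeight a b (k + 1) * rowWeight c d (k + 1))

theorem pairProduct_swap (M : ℕ) (a b c d : R) :
    pairProduct M c d a b = pairProduct M a b c d :=
  Finset.prod_congr rfl fun k _ => by rw [mul_comm (rowWeight c d _)]

theorem pairProduct_succ (M : ℕ) (a b c d : R) :
    pairProduct (M + 1) a b c d =
      pairProduct M a b c d * (1 - rowWeight a b (M + 1) * rowWeight c d (M + 1)) :=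
  Finset.prod_range_succ _ M

theorem rowWeight_mul_rowWeight_odd (a b c d : R) (m : ℕ) :
    rowWeight a b (2 * m + 1) * rowWeight c d (2 * m + 1) = a * c * (a * b * c * d) ^ m := by
  rw [rowWeight_two_mul_add_one, rowWeight_two_mul_add_one,
    show a * b * c * d = (a * b) * (c * d) by ring, mul_pow]
  ring

theorem rowWeight_mul_rowWeight_even (a b c d : R) (m : ℕ) :
    rowWeight a b (2 * m) * rowWeight c d (2 * m) = (a * b * c * d) ^ m := by
  rw [rowWeight_two_mul, rowWeight_two_mul, ← mul_pow, ← mul_assoc (a * b)]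

theorem pairProduct_eq_qPoch {ν : ℕ} (hν : ν = 0 ∨ ν = 1) (N : ℕ) (a b c d : R) :
    pairProduct (2 * N + ν) a b c d =
      qPoch (a * b * c * d) (a * b * c * d) N * qPoch (a * c) (a * b * c * d) (N + ν) := by
  have h0 (m : ℕ) : pairProduct (2 * m) a b c d =
      qPoch (a * b * c * d) (a * b * c * d) m * qPoch (a * c) (a * b * c * d) m := by
    induction m with
    | zero => simp [pairProduct, qPoch]
    | succ m ih =>
      rw [show 2 * (m + 1) = 2 * m + 1 + 1 by ring, pairProduct_succ, pairProduct_succ, ih,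
        rowWeight_mul_rowWeight_odd, show 2 * m + 1 + 1 = 2 * (m + 1) by ring,
        rowWeight_mul_rowWeight_even, qPoch_succ, qPoch_succ]
      ring
  rcases hν with rfl | rfl
  · exact h0 N
  · rw [pairProduct_succ, h0, rowWeight_mul_rowWeight_odd, qPoch_succ]
    ring

/-- Splitting off a first row of the maximal length, for series over bounded partitions. -/
theorem tsum_boundedPartitions_succ [TopologicalSpace R] [IsTopologicalRing R] [T2Space R]
    (M : ℕ) (a b c d : R)
    (h : Summable fun μ : boundedPartitions M => diagramWeight a b c d μ.1)
    (h' : Summable fun μ : boundedPartitions (M + 1) => diagramWeight c d a b μ.1) :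
    ∑' μ : boundedPartitions (M + 1), diagramWeight a b c d μ.1 =
      ∑' μ : boundedPartitions M, diagramWeight a b c d μ.1 +
        rowWeight a b (M + 1) * ∑' μ : boundedPartitions (M + 1), diagramWeight c d a b μ.1 := by
  have hinj : Function.Injective fun μ => (addRow M μ).1 :=
    Subtype.val_injective.comp (addRow_injective M)
  have h2 : HasSum (diagramWeight a b c d ∘ fun μ => (addRow M μ).1)
      (rowWeight a b (M + 1) * ∑' μ : boundedPartitions (M + 1), diagramWeight c d a b μ.1) := by
    simpa only [Function.comp_def, diagramWeight_addRow] using h'.hasSum.mul_left _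
  have h3 := HasSum.add_disjoint (f := diagramWeight a b c d) (Set.disjoint_left.2 ?_)
    h.hasSum (hinj.hasSum_range_iff.2 h2)
  · rw [← boundedPartitions_succ] at h3
    exact h3.tsum_eq
  · rintro _ h4 ⟨ν, rfl⟩
    exact addRow_notMem M ν h4

/-- Deleting pairs of equal rows relates the series over all bounded partitions to the one over
those with distinct parts. -/
theorem tsum_boundedPartitions_mul_pairProduct [TopologicalSpace R] [IsTopologicalRing R]
    [T2Space R] (M : ℕ) (a b c d : R)
    (h : ∀ k ≤ M, Summable fun μ : boundedPartitions k => diagramWeight a b c d μ.1)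
    (h' : ∀ k ≤ M, Summable fun μ : boundedPartitions k => diagramWeight c d a b μ.1) :
    (∑' μ : boundedPartitions M, diagramWeight a b c d μ.1) * pairProduct M a b c d =
      distinctGenFun M a b c d := by
  induction M generalizing a b c d with
  | zero =>
    rw [boundedPartitions_zero, tsum_singleton (⊥ : YoungDiagram) (diagramWeight a b c d)]
    simp [diagramWeight_bot, pairProduct, distinctGenFun_zero]
  | succ M ih =>
    have e1 := tsum_boundedPartitions_succ M a b c d (h M M.le_succ) (h' _ le_rfl)
    have e2 := tsum_boundedPartitions_succ M c d a b (h' M M.le_succ) (h _ le_rfl)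
    have e3 := ih a b c d (fun k hk => h k (by omega)) (fun k hk => h' k (by omega))
    have e4 := ih c d a b (fun k hk => h' k (by omega)) (fun k hk => h k (by omega))
    rw [pairProduct_swap] at e4
    rw [pairProduct_succ, distinctGenFun_succ]
    linear_combination e3 + rowWeight a b (M + 1) * e4 +
      pairProduct M a b c d * (e1 + rowWeight a b (M + 1) * e2)

/-! ### Summability -/

/-- Two additional rows leave the roles of the letters unchanged. -/
theorem diagramWeight_addRow_iterate (a b c d : R) (M n : ℕ) (μ : boundedPartitions (M + 1)) :
    diagramWeight a b c d ((addRow M)^[2 * n] μ).1 =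
      (rowWeight a b (M + 1) * rowWeight c d (M + 1)) ^ n * diagramWeight a b c d μ.1 := by
  induction n with
  | zero => simp
  | succ n ih =>
    rw [show 2 * (n + 1) = 2 * n + 1 + 1 by ring, Function.iterate_succ_apply',
      Function.iterate_succ_apply', diagramWeight_addRow, diagramWeight_addRow, ih]
    ring

/-- Every diagram with rows of length at most `M + 1` arises by adding an even number of rows of
length `M + 1` to a diagram that has at most one such row. -/
theorem exists_addRow_iterate_eq (M : ℕ) (μ : boundedPartitions (M + 1)) :
    ∃ (n : ℕ) (ν : boundedPartitions M),
      (addRow M)^[2 * n] (Set.inclusion (boundedPartitions_mono M.le_succ) ν) = μ ∨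
      (addRow M)^[2 * n] (addRow M (Set.inclusion (boundedPartitions_mono M.le_succ) ν)) = μ := by
  induction hl : μ.1.rowLens.length using Nat.strong_induction_on generalizing μ with
  | _ l ih =>
    by_cases h : μ.1 ∈ boundedPartitions M
    · exact ⟨0, ⟨μ.1, h⟩, Or.inl rfl⟩
    · obtain ⟨μ₁, h₁⟩ := exists_addRow_eq μ.2 h
      obtain rfl := Subtype.ext h₁
      by_cases h' : μ₁.1 ∈ boundedPartitions M
      · exact ⟨0, ⟨μ₁.1, h'⟩, Or.inr rfl⟩
      · obtain ⟨μ₂, h₂⟩ := exists_addRow_eq μ₁.2 h'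
        obtain rfl := Subtype.ext h₂
        obtain ⟨n, ν, hn⟩ := ih _ (by simp [← hl, rowLens_addRow]) μ₂ rfl
        refine ⟨n + 1, ν, ?_⟩
        rw [show 2 * (n + 1) = 2 * n + 1 + 1 by ring]
        simp only [Function.iterate_succ_apply']
        exact hn.imp (fun h => by rw [h]) (fun h => by rw [h])

theorem summable_norm_diagramWeight {𝕜 : Type*} [NormedField 𝕜] (M : ℕ) (a b c d : 𝕜)
    (h : ∀ k < M, ‖rowWeight a b (k + 1) * rowWeight c d (k + 1)‖ < 1) :
    Summable fun μ : boundedPartitions M => ‖diagramWeight a b c d μ.1‖ := by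
  induction M generalizing a b c d with
  | zero =>
    have : Finite (boundedPartitions 0) := by rw [boundedPartitions_zero]; infer_instance
    exact Summable.of_finite
  | succ M ih =>
    have hg : Summable fun n : ℕ => ‖rowWeight a b (M + 1) * rowWeight c d (M + 1)‖ ^ n :=
      summable_geometric_of_lt_one (norm_nonneg _) (h M M.lt_succ_self)
    have h1 := ih a b c d fun k hk => h k (by omega)
    have h2 := (ih c d a b fun k hk => by rw [mul_comm]; exact h k (by omega)).mul_left
      ‖rowWeight a b (M + 1)‖
    have h3 := hg.mul_of_nonneg h1 (fun _ => by positivity) fun _ => norm_nonneg _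
    have h4 := hg.mul_of_nonneg h2 (fun _ => by positivity) fun _ => by positivity
    -- The series over `U_{M+1}` is dominated by the sum of the series over `ℕ × U_M` for an even
    -- and for an odd number of rows of length `M + 1`.
    let e : (ℕ × boundedPartitions M) ⊕ (ℕ × boundedPartitions M) → boundedPartitions (M + 1) :=
      Sum.elim
        (fun x => (addRow M)^[2 * x.1] (Set.inclusion (boundedPartitions_mono M.le_succ) x.2))
        (fun x => (addRow M)^[2 * x.1]
          (addRow M (Set.inclusion (boundedPartitions_mono M.le_succ) x.2)))
    have he : Function.Surjective e := by
      intro μ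
      obtain ⟨n, ν, hn | hn⟩ := exists_addRow_iterate_eq M μ
      · exact ⟨Sum.inl (n, ν), hn⟩
      · exact ⟨Sum.inr (n, ν), hn⟩
    have hs : Summable ((fun μ : boundedPartitions (M + 1) => ‖diagramWeight a b c d μ.1‖) ∘ e) := by
      refine Summable.sum _ ?_ ?_
      · refine h3.congr fun x => ?_
        simp [e, diagramWeight_addRow_iterate, mul_pow]
      · refine h4.congr fun x => ?_
        simp [e, diagramWeight_addRow_iterate, diagramWeight_addRow, mul_pow]
    have hs' := hs.comp_injective (Function.injective_surjInv he)
    refine hs'.congr fun μ => ?_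
    simp [Function.surjInv_eq he]

theorem MvPowerSeries.coeff_prod_X_eq_zero {σ ι : Type*} (s : ι → σ) (t : Finset ι) (e : σ →₀ ℕ)
    (h : e.degree ≠ t.card) : coeff e (∏ x ∈ t, (X (s x) : MvPowerSeries σ R)) = 0 := by
  classical
  have h1 : ∏ x ∈ t, (X (s x) : MvPowerSeries σ R) =
      monomial (∑ x ∈ t, Finsupp.single (s x) 1) 1 := by
    clear h
    induction t using Finset.induction_on with
    | empty => simp
    | insert x t hx ih =>
      rw [Finset.prod_insert hx, ih, Finset.sum_insert hx, X, monomial_mul_monomial, one_mul]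
  rw [h1, coeff_monomial, if_neg]
  rintro rfl
  simp [Finsupp.degree_single] at h

theorem finite_card_eq (n : ℕ) : {μ : YoungDiagram | μ.cells.card = n}.Finite := by
  refine Set.Finite.of_finite_image (f := YoungDiagram.cells) ?_
    (fun μ _ ν _ h => YoungDiagram.ext h)
  refine (Finset.finite_toSet (Finset.range n ×ˢ Finset.range n).powerset).subset ?_
  rintro _ ⟨μ, rfl, rfl⟩
  simp only [Finset.coe_powerset, Set.mem_preimage, Set.mem_powerset_iff]
  rintro ⟨i, j⟩ hx
  -- A diagram with the cell `(i, j)` contains the `(i + 1) × (j + 1)` rectangle.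
  have hsub : Finset.range (i + 1) ×ˢ Finset.range (j + 1) ⊆ μ.cells := by
    rintro ⟨i', j'⟩ h
    simp only [Finset.mem_product, Finset.mem_range] at h
    exact μ.up_left_mem (by omega) (by omega) hx
  have hcard := Finset.card_le_card hsub
  simp only [Finset.card_product, Finset.card_range] at hcard
  simp only [Finset.coe_product, Set.mem_prod, Finset.mem_coe, Finset.mem_range]
  constructor <;> nlinarith

/-- In the ring of formal power series the weights of the diagrams are summable, since only
finitely many of them have a given degree. -/
theorem summable_diagramWeight_X {σ : Type*} [TopologicalSpace R] (M : ℕ) (p q r s : σ) :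
    Summable fun μ : boundedPartitions M =>
      diagramWeight (MvPowerSeries.X p : MvPowerSeries σ R) (MvPowerSeries.X q)
        (MvPowerSeries.X r) (MvPowerSeries.X s) μ.1 := by
  have hX (x : ℕ × ℕ) : ∃ t : σ, boxLetter (MvPowerSeries.X p : MvPowerSeries σ R)
      (MvPowerSeries.X q) (MvPowerSeries.X r) (MvPowerSeries.X s) x = MvPowerSeries.X t := by
    unfold boxLetter
    split_ifs <;> exact ⟨_, rfl⟩
  choose t ht using hX
  refine MvPowerSeries.WithPiTopology.summable_iff_summable_coeff.2 fun e => ?_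
  refine summable_of_hasFiniteSupport
    (((finite_card_eq e.degree).preimage Subtype.val_injective.injOn).subset fun μ hμ => ?_)
  by_contra hne
  refine hμ ?_
  simp only [diagramWeight, ht]
  exact MvPowerSeries.coeff_prod_X_eq_zero t _ e (Ne.symm hne)

end Bounded

/-! ### Passage to quotients of `q`-factorials -/

/-!
The inverse in the definition of `qBinom` is that of a field or of a ring of formal power series over
a field; the hypothesis `hinv` states what both have in common.
-/

section Inverse

variable {R : Type*} [CommRing R]

theorem isUnit_qPoch_of_le {x q : R} {m n : ℕ} (h : m ≤ n) (hu : IsUnit (qPoch x q n)) :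
    IsUnit (qPoch x q m) := by
  obtain ⟨k, rfl⟩ := Nat.exists_eq_add_of_le h
  rw [qPoch_add] at hu
  exact isUnit_of_mul_isUnit_left hu

variable [Inv R]

theorem qBinom_eq_gaussBinom (hinv : ∀ x : R, IsUnit x → x * x⁻¹ = 1) {q : R} {n k : ℕ}
    (hk : k ≤ n) (hu : IsUnit (qPoch q q n)) : qBinom q n k = gaussBinom q n k := by
  have h := hinv _ ((isUnit_qPoch_of_le hk hu).mul (isUnit_qPoch_of_le (Nat.sub_le n k) hu))
  rw [qBinom, if_pos hk, ← gaussBinom_mul_qPoch q hk, mul_assoc, h, mul_one]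

theorem closedForm_eq_sum_qBinom (hinv : ∀ x : R, IsUnit x → x * x⁻¹ = 1) (a b c q : R)
    (ν N : ℕ) (hq : IsUnit (qPoch q q N)) (hac : IsUnit (qPoch (a * c) q (N + ν))) :
    closedForm a b (a * c) q ν N = ∑ i ∈ Finset.range (N + 1),
      qBinom q N i * (qPoch (-a) q (i + ν) * qPoch (-(a * b * c)) q i) *
        (qPoch (a * c) q (N + ν) * (qPoch (a * c) q (i + ν))⁻¹) * (a * b) ^ (N - i) := by
  refine Finset.sum_congr rfl fun i hi => ?_
  have hi : i ≤ N := Nat.lt_succ_iff.1 (Finset.mem_range.1 hi)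
  have h1 := hinv _ (isUnit_qPoch_of_le (Nat.add_le_add_right hi ν) hac)
  rw [qBinom_eq_gaussBinom hinv hi hq, closedTerm, show N + ν = i + ν + (N - i) by omega,
    qPoch_add (a * c) q (i + ν), show b * (a * c) = a * b * c by ring]
  linear_combination (-(gaussBinom q N i * (qPoch (-a) q (i + ν) * qPoch (-(a * b * c)) q i) *
    qPoch (a * c * q ^ (i + ν)) q (N - i) * (a * b) ^ (N - i))) * h1

theorem eq_of_mul_eq_closedForm (hinv : ∀ x : R, IsUnit x → x * x⁻¹ = 1) {a b c q T : R}
    {ν N : ℕ} (hq : IsUnit (qPoch q q N)) (hac : IsUnit (qPoch (a * c) q (N + ν)))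
    (hT : T * (qPoch q q N * qPoch (a * c) q (N + ν)) = closedForm a b (a * c) q ν N) :
    T = (qPoch q q N)⁻¹ * ∑ i ∈ Finset.range (N + 1),
      qBinom q N i * (qPoch (-a) q (i + ν) * qPoch (-(a * b * c)) q i *
        (qPoch (a * c) q (i + ν))⁻¹) * (a * b) ^ (N - i) := by
  rw [closedForm_eq_sum_qBinom hinv a b c q ν N hq hac] at hT
  refine (hq.mul hac).mul_right_cancel (hT.trans ?_)
  rw [← mul_assoc, mul_right_comm _ _ (qPoch q q N), mul_comm _ (qPoch q q N), hinv _ hq, one_mul,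
    Finset.sum_mul]
  exact Finset.sum_congr rfl fun i _ => by ring

/-- The first identity, in any topological ring in which the series over bounded partitions are
summable and the denominators are invertible. -/
theorem hasSum_boundedPartitions [TopologicalSpace R] [IsTopologicalRing R] [T2Space R]
    (hinv : ∀ x : R, IsUnit x → x * x⁻¹ = 1) {ν : ℕ} (hν : ν = 0 ∨ ν = 1) (N : ℕ) (a b c d : R)
    (h : ∀ k ≤ 2 * N + ν, Summable fun μ : boundedPartitions k => diagramWeight a b c d μ.1)
    (h' : ∀ k ≤ 2 * N + ν, Summable fun μ : boundedPartitions k => diagramWeight c d a b μ.1)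
    (hq : IsUnit (qPoch (a * b * c * d) (a * b * c * d) N))
    (hac : IsUnit (qPoch (a * c) (a * b * c * d) (N + ν))) :
    HasSum (fun μ : boundedPartitions (2 * N + ν) => diagramWeight a b c d μ.1)
      ((qPoch (a * b * c * d) (a * b * c * d) N)⁻¹ * ∑ i ∈ Finset.range (N + 1),
        qBinom (a * b * c * d) N i * (qPoch (-a) (a * b * c * d) (i + ν) *
          qPoch (-(a * b * c)) (a * b * c * d) i *
            (qPoch (a * c) (a * b * c * d) (i + ν))⁻¹) * (a * b) ^ (N - i)) := by
  have h1 := tsum_boundedPartitions_mul_pairProduct (2 * N + ν) a b c d h h'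
  rw [pairProduct_eq_qPoch hν, distinctGenFun_eq_closedForm hν] at h1
  rw [← eq_of_mul_eq_closedForm hinv hq hac h1]
  exact (h _ le_rfl).hasSum

end Inverse

/-! ### Complex numbers and formal power series -/

theorem norm_mul_pow_lt_one {x q : ℂ} (hx : ‖x‖ < 1) (hq : ‖q‖ < 1) (n : ℕ) :
    ‖x * q ^ n‖ < 1 := by
  rw [norm_mul, norm_pow]
  exact mul_lt_one_of_nonneg_of_lt_one_left (norm_nonneg x) hx
    (pow_le_one₀ (norm_nonneg q) hq.le)

theorem qPoch_ne_zero_of_norm_lt_one {x q : ℂ} (hx : ‖x‖ < 1) (hq : ‖q‖ < 1) (n : ℕ) :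
    qPoch x q n ≠ 0 := by
  refine Finset.prod_ne_zero_iff.2 fun i _ h => ?_
  have h1 := norm_mul_pow_lt_one hx hq i
  rw [← sub_eq_zero.1 h, norm_one] at h1
  exact lt_irrefl _ h1

theorem norm_rowWeight_mul_rowWeight_lt_one {a b c d : ℂ} (hQ : ‖a * b * c * d‖ < 1)
    (hac : ‖a * c‖ < 1) (k : ℕ) : ‖rowWeight a b (k + 1) * rowWeight c d (k + 1)‖ < 1 := by
  obtain ⟨m, rfl | rfl⟩ := Nat.even_or_odd' k
  · rw [rowWeight_mul_rowWeight_odd]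
    exact norm_mul_pow_lt_one hac hQ m
  · rw [show 2 * m + 1 + 1 = 2 * (m + 1) by ring, rowWeight_mul_rowWeight_even, pow_succ']
    exact norm_mul_pow_lt_one hQ hQ m

theorem MvPowerSeries.isUnit_qPoch {σ K : Type*} [Field K] {x q : MvPowerSeries σ K}
    (hx : constantCoeff x = 0) (n : ℕ) : IsUnit (qPoch x q n) := by
  rw [MvPowerSeries.isUnit_iff_constantCoeff, qPoch, map_prod]
  simp [hx]

theorem mainTheorem8 {K : Type*} [Field K] [TopologicalSpace K] [DiscreteTopology K]
    (N ν : ℕ) (hν : ν = 0 ∨ ν = 1) :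
    -- the identities for formal variables, in the ring of formal power series in `a, b, c, d`
    (let a : MvPowerSeries (Fin 4) K := MvPowerSeries.X 0
     let b : MvPowerSeries (Fin 4) K := MvPowerSeries.X 1
     let c : MvPowerSeries (Fin 4) K := MvPowerSeries.X 2
     let d : MvPowerSeries (Fin 4) K := MvPowerSeries.X 3
     let Q := a * b * c * d
     HasSum (fun μ : boundedPartitions (2 * N + ν) => diagramWeight a b c d μ.1)
        ((qPoch Q Q N)⁻¹ * ∑ i ∈ Finset.range (N + 1),
          qBinom Q N i * (qPoch (-a) Q (i + ν) * qPoch (-(a * b * c)) Q i *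
            (qPoch (a * c) Q (i + ν))⁻¹) * (a * b) ^ (N - i)) ∧
      distinctGenFun (2 * N + ν) a b c d =
        ∑ i ∈ Finset.range (N + 1),
          qBinom Q N i * (qPoch (-a) Q (i + ν) * qPoch (-(a * b * c)) Q i) *
            (qPoch (a * c) Q (N + ν) * (qPoch (a * c) Q (i + ν))⁻¹) * (a * b) ^ (N - i)) ∧
    -- the identities for complex values of the variables
    (∀ a b c d Q : ℂ, Q = a * b * c * d →
      (‖Q‖ < 1 → ‖a * c‖ < 1 →
        HasSum (fun μ : boundedPartitions (2 * N + ν) => diagramWeight a b c d μ.1)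
          (1 / qPoch Q Q N * ∑ i ∈ Finset.range (N + 1),
            qBinom Q N i * (qPoch (-a) Q (i + ν) * qPoch (-(a * b * c)) Q i /
              qPoch (a * c) Q (i + ν)) * (a * b) ^ (N - i))) ∧
      (qPoch Q Q N ≠ 0 → qPoch (a * c) Q (N + ν) ≠ 0 →
        distinctGenFun (2 * N + ν) a b c d =
          ∑ i ∈ Finset.range (N + 1),
            qBinom Q N i * (qPoch (-a) Q (i + ν) * qPoch (-(a * b * c)) Q i) *
              (qPoch (a * c) Q (N + ν) / qPoch (a * c) Q (i + ν)) * (a * b) ^ (N - i))) := by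
  refine ⟨?_, ?_⟩
  · have hinv (x : MvPowerSeries (Fin 4) K) (hx : IsUnit x) : x * x⁻¹ = 1 :=
      MvPowerSeries.mul_inv_cancel x
        (MvPowerSeries.isUnit_iff_constantCoeff.1 hx).ne_zero
    intro a b c d Q
    have hq : IsUnit (qPoch Q Q N) := MvPowerSeries.isUnit_qPoch (by simp [Q, a]) N
    have hac : IsUnit (qPoch (a * c) Q (N + ν)) := MvPowerSeries.isUnit_qPoch (by simp [a]) (N + ν)
    refine ⟨hasSum_boundedPartitions hinv hν N a b c d
      (fun k _ => summable_diagramWeight_X k 0 1 2 3)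
      (fun k _ => summable_diagramWeight_X k 2 3 0 1) hq hac, ?_⟩
    rw [distinctGenFun_eq_closedForm hν]
    exact closedForm_eq_sum_qBinom hinv a b c Q ν N hq hac
  · have hinv (x : ℂ) (hx : IsUnit x) : x * x⁻¹ = 1 := mul_inv_cancel₀ hx.ne_zero
    rintro a b c d _ rfl
    simp only [div_eq_mul_inv, one_mul]
    refine ⟨fun hQ h => ?_, fun hq hac => ?_⟩
    · have hb := norm_rowWeight_mul_rowWeight_lt_one hQ h
      exact hasSum_boundedPartitions hinv hν N a b c d
        (fun k _ => (summable_norm_diagramWeight k a b c d fun j _ => hb j).of_norm)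
        (fun k _ => (summable_norm_diagramWeight k c d a b fun j _ => by
          rw [mul_comm]; exact hb j).of_norm)
        (qPoch_ne_zero_of_norm_lt_one hQ hQ N).isUnit
        (qPoch_ne_zero_of_norm_lt_one h hQ (N + ν)).isUnit
    · rw [distinctGenFun_eq_closedForm hν]
      exact closedForm_eq_sum_qBinom hinv a b c _ ν N hq.isUnit hac.isUnit
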